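/- **Setting.** Let $L$ be a Lipschitz language: constant symbols, and function symbols $F$ and relation symbols $R$ of arities $\ge 1$ with Lipschitz constants $\lambda_F,\lambda_R\ge 0$. An $L$-prestructure is a pseudometric space $(M,d)$ of diameter at most $1$ with elements $c^M\in M$, maps $F^M:M^n\to M$ with $d(F^M(\bar a),F^M(\bar b))\le\lambda_F\sum_k d(a_k,b_k)$ and maps $R^M:M^n\to[0,1]$ with $R^M(\bar a)-R^M(\bar b)\le\lambda_R\sum_k d(a_k,b_k)$. An $L$-structure is a prestructure in which $d$ is a complete metric. (Affine) $L$-formulas are built from the atomic formulas $1$, $d(t_1,t_2)$, $R(t_1,\dots,t_n)$ ($t_k$ terms) by $\phi+\psi$, $r\phi$ ($r\in\mathbb R$), $\sup_x\phi$ and $\inf_x\phi$; the value $\phi^M(\bar a)\in\mathbb R$ is defined in the obvious way, $\sup_x$ and $\inf_x$ ranging over $x\in M$. A map $f:M\to N$ is an elementary embedding if $\phi^M(\bar a)=\phi^N(f(\bar a))$ for all formulas $\phi$ and all tuples $\bar a$ in $M$. Let $(I,\mathcal A,\mu)$ be a charge space: $\mathcal A$ is a Boolean algebra of subsets of $I$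 and $\mu:\mathcal A\to[0,1]$ is a finitely additive probability, $\mu(I)=1$. Bounded real functions on $I$ are integrated with respect to $\mu$ in the usual way: $f$ is integrable if the supremum of the integrals of the $\mathcal A$-simple functions below $f$ equals the infimum of those of the $\mathcal A$-simple functions above $f$, and $\int f\,d\mu$ is the common value. Let $w(M)$ be the least cardinality of a base of the topology of $M$, plus $\aleph_0$. An $L$-structure $M$ is $\mathcal A$-meanable if $M$ is finite or $\mathcal A$ is $w(M)^+$-complete, i.e. closed under intersections of at most $w(M)$ members. A map $a:I\to M$ is measurable if $a^{-1}(B)\in\mathcal A$ for every Borel set $B\subseteq M$. For an $\mathcal A$-meanable $L$-structure $M$, the measurable powermean $M^\mu$ is the set of classes $[a_i]$ of measurable maps $a=(a_i)_{i\in I}:I\to M$, where $a\sim b$ iff $\int d(a_i,b_i)\,d\mu=0$, with the metric $d([a_i],[b_i])=\int d(a_i,b_i)\,d\mu$ and $$c^{M^\mu}=[c^M],\qquad F^{M^\mu}([a^1_i],\dots,[a^n_i])=[F^M(a^1_i,\dots,a^n_i)],\qquad R^{M^\mu}([a^1_i],\dots,[a^n_i])=\int R^M(a^1_i,\dots,a^n_i)\,d\mu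 .$$ It is an $L$-prestructure on a (possibly incomplete) metric space. **Theorem (Powermean).** Let $(I,\mathcal A,\mu)$ be a charge space and $M$ an $\mathcal A$-meanable $L$-structure. Then for every $n\ge 0$, every $L$-formula $\phi(x_1,\dots,x_n)$ and all measurable $a^1,\dots,a^n:I\to M$, the bounded function $i\mapsto\phi^M(a^1_i,\dots,a^n_i)$ is integrable and $$\phi^{M^\mu}([a^1_i],\dots,[a^n_i])=\int\phi^M(a^1_i,\dots,a^n_i)\,d\mu .$$ Consequently, the diagonal map $M\to M^\mu$, sending $x$ to the class of the constant map with value $x$, is an elementary embedding. -/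

import Mathlib

open MeasureTheory Set

noncomputable section

namespace AffineLogic

universe u₁ u₂ u₃ v w

/-! ### Affine continuous logic -/

/-- A Lipschitz language: constant symbols, and function and relation symbols with an arity at
least `1` and a nonnegative Lipschitz constant. The metric symbol `d` is treated as a logical
symbol. -/
structure LipschitzLanguage where
  Const : Type u₁
  Fn : Type u₂
  Rel : Type u₃
  fnArity : Fn → ℕ
  fnArity_pos : ∀ F, 1 ≤ fnArity F
  fnLip : Fn → NNReal
  relArity : Rel → ℕ
  relArity_pos : ∀ R, 1 ≤ relArity R
  relLip : Rel → NNReal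

/-- `L`-terms whose variables are among `x₀, …, xₙ₋₁`. -/
inductive Term (L : LipschitzLanguage.{u₁, u₂, u₃}) (n : ℕ) : Type (max u₁ u₂)
  | var (k : Fin n) : Term L n
  | const (c : L.Const) : Term L n
  | app (F : L.Fn) (t : Fin (L.fnArity F) → Term L n) : Term L n

/-- (Affine) `L`-formulas whose free variables are among `x₀, …, xₙ₋₁`. A quantifier binds the
last variable. -/
inductive Formula (L : LipschitzLanguage.{u₁, u₂, u₃}) : ℕ → Type (max u₁ u₂ u₃)
  | one {n : ℕ} : Formula L n
  | dist {n : ℕ} (t₁ t₂ : Term L n) : Formula L n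
  | rel {n : ℕ} (R : L.Rel) (t : Fin (L.relArity R) → Term L n) : Formula L n
  | add {n : ℕ} (φ ψ : Formula L n) : Formula L n
  | smul {n : ℕ} (r : ℝ) (φ : Formula L n) : Formula L n
  | inf {n : ℕ} (φ : Formula L (n + 1)) : Formula L n
  | sup {n : ℕ} (φ : Formula L (n + 1)) : Formula L n

/-- An `L`-prestructure on a pseudometric space `M`: the diameter is at most `1`, and all symbols
are interpreted by Lipschitz maps with the prescribed constants, where `Mⁿ` carries the
pseudometric `∑ d(xᵢ, yᵢ)`. A *structure* is a prestructure on a complete metric space. -/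
class Prestructure (L : LipschitzLanguage.{u₁, u₂, u₃}) (M : Type w) [PseudoMetricSpace M] where
  dist_le_one : ∀ x y : M, dist x y ≤ 1
  const : L.Const → M
  fn : ∀ F : L.Fn, (Fin (L.fnArity F) → M) → M
  fn_lip : ∀ F a b, dist (fn F a) (fn F b) ≤ L.fnLip F * ∑ k, dist (a k) (b k)
  rel : ∀ R : L.Rel, (Fin (L.relArity R) → M) → ℝ
  rel_mem : ∀ R a, rel R a ∈ Icc (0 : ℝ) 1
  rel_lip : ∀ R a b, rel R a - rel R b ≤ L.relLip R * ∑ k, dist (a k) (b k)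

section Semantics

variable {L : LipschitzLanguage.{u₁, u₂, u₃}} {M : Type w} [PseudoMetricSpace M] [Prestructure L M]

/-- The value `t^M(a)` of a term. -/
def Term.value {n : ℕ} (a : Fin n → M) : Term L n → M
  | .var k => a k
  | .const c => Prestructure.const c
  | .app F t => Prestructure.fn F (fun k => (t k).value a)

/-- The value `φ^M(a)` of a formula. -/
def Formula.value : {n : ℕ} → Formula L n → (Fin n → M) → ℝ
  | _, .one, _ => 1
  | _, .dist t₁ t₂, a => Dist.dist (t₁.value a) (t₂.value a)
  | _, .rel R t, a => Prestructure.rel R (fun k => (t k).value a)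
  | _, .add φ ψ, a => φ.value a + ψ.value a
  | _, .smul r φ, a => r * φ.value a
  | _, .inf φ, a => ⨅ b : M, φ.value (Fin.snoc a b : Fin (_ + 1) → M)
  | _, .sup φ, a => ⨆ b : M, φ.value (Fin.snoc a b : Fin (_ + 1) → M)

/-- A map is an elementary embedding if it preserves the values of all formulas. -/
def IsElementaryEmbedding (L : LipschitzLanguage.{u₁, u₂, u₃}) {M : Type v} {N : Type w}
    [PseudoMetricSpace M] [Prestructure L M] [PseudoMetricSpace N] [Prestructure L N]
    (f : M → N) : Prop :=
  ∀ (n : ℕ) (φ : Formula L n) (a : Fin n → M), φ.value a = φ.value (fun k => f (a k))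

/-- A representative of a class of points at distance `0`. -/
def rep {M : Type w} [PseudoMetricSpace M] (x : SeparationQuotient M) : M :=
  Function.surjInv SeparationQuotient.surjective_mk x

theorem mk_rep {M : Type w} [PseudoMetricSpace M] (x : SeparationQuotient M) :
    SeparationQuotient.mk (rep x) = x :=
  Function.surjInv_eq SeparationQuotient.surjective_mk x

/-- Identification of the points at distance `0` in a prestructure. Symbols are interpreted on
representatives; by `mk_fn` and `mk_rel` below the choice does not matter. -/
instance instPrestructureSeparationQuotient : Prestructure L (SeparationQuotient M) where
  dist_le_one x y := by
    obtain ⟨x, rfl⟩ := SeparationQuotient.surjective_mk x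
    obtain ⟨y, rfl⟩ := SeparationQuotient.surjective_mk y
    exact Prestructure.dist_le_one (L := L) x y
  const c := SeparationQuotient.mk (Prestructure.const c)
  fn F a := SeparationQuotient.mk
    (Prestructure.fn F fun k => rep (a k))
  fn_lip F a b := by
    rw [SeparationQuotient.dist_mk]
    refine (Prestructure.fn_lip F _ _).trans (le_of_eq ?_)
    congr 1
    refine Finset.sum_congr rfl fun k _ => ?_
    rw [← SeparationQuotient.dist_mk, mk_rep, mk_rep]
  rel R a := Prestructure.rel R fun k => rep (a k)
  rel_mem R a := Prestructure.rel_mem R _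
  rel_lip R a b := by
    refine (Prestructure.rel_lip R _ _).trans (le_of_eq ?_)
    congr 1
    refine Finset.sum_congr rfl fun k _ => ?_
    rw [← SeparationQuotient.dist_mk, mk_rep, mk_rep]

theorem sum_dist_rep {n : ℕ} (a : Fin n → M) :
    ∑ k, dist (rep (SeparationQuotient.mk (a k)))
      (a k) = 0 := by
  refine Finset.sum_eq_zero fun k _ => ?_
  rw [← SeparationQuotient.dist_mk, mk_rep, dist_self]

theorem mk_fn (F : L.Fn) (a : Fin (L.fnArity F) → M) :
    (Prestructure.fn F fun k => SeparationQuotient.mk (a k) : SeparationQuotient M) =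
      SeparationQuotient.mk (Prestructure.fn F a) := by
  refine SeparationQuotient.mk_eq_mk.2 (Metric.inseparable_iff.2 (le_antisymm ?_ dist_nonneg))
  refine (Prestructure.fn_lip F _ _).trans ?_
  rw [sum_dist_rep, mul_zero]

theorem mk_rel (R : L.Rel) (a : Fin (L.relArity R) → M) :
    Prestructure.rel R (fun k => SeparationQuotient.mk (a k)) = Prestructure.rel R a := by
  have h := Prestructure.rel_lip R
    (fun k => rep (SeparationQuotient.mk (a k))) a
  have h' := Prestructure.rel_lip R a
    (fun k => rep (SeparationQuotient.mk (a k)))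
  rw [sum_dist_rep, mul_zero] at h
  simp_rw [dist_comm (a _)] at h'
  rw [sum_dist_rep, mul_zero] at h'
  exact le_antisymm (sub_nonpos.1 h) (sub_nonpos.1 h')

end Semantics

/-! ### Charges and integration -/

/-- A (probability) charge space: a Boolean algebra of subsets of `I` with a finitely additive
probability on it. -/
structure ChargeSpace (I : Type v) where
  sets : Set (Set I)
  isSetAlgebra : IsSetAlgebra sets
  charge : AddContent NNReal sets
  charge_univ : charge univ = 1

namespace ChargeSpace

variable {I : Type v} (𝓘 : ChargeSpace I)

/-- A simple function: finitely many measurable cells, and a real value on each cell. -/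
structure SimpleFunction where
  n : ℕ
  cell : I → Fin n
  cell_mem : ∀ k, cell ⁻¹' {k} ∈ 𝓘.sets
  val : Fin n → ℝ

/-- The integral of a simple function. -/
def SimpleFunction.integral {𝓘 : ChargeSpace I} (s : 𝓘.SimpleFunction) : ℝ :=
  ∑ k, s.val k * (𝓘.charge (s.cell ⁻¹' {k}) : ℝ)

/-- The integrals of the simple functions below `f`. -/
def lowerSums (f : I → ℝ) : Set ℝ :=
  {x | ∃ s : 𝓘.SimpleFunction, (∀ i, s.val (s.cell i) ≤ f i) ∧ s.integral = x}

/-- The integrals of the simple functions above `f`. -/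
def upperSums (f : I → ℝ) : Set ℝ :=
  {x | ∃ s : 𝓘.SimpleFunction, (∀ i, f i ≤ s.val (s.cell i)) ∧ s.integral = x}

/-- A bounded function is integrable if its lower and upper integrals agree. (Only bounded
functions are integrated here.) -/
def Integrable (f : I → ℝ) : Prop :=
  (∃ B : ℝ, ∀ i, |f i| ≤ B) ∧ sSup (𝓘.lowerSums f) = sInf (𝓘.upperSums f)

/-- The integral of a bounded integrable function. -/
def integral (f : I → ℝ) : ℝ := sSup (𝓘.lowerSums f)

/-- A map into a topological space is measurable if the preimages of Borel sets are in the
algebra. -/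
def IsMeasurable {M : Type w} [TopologicalSpace M] (a : I → M) : Prop :=
  ∀ B : Set M, MeasurableSet[borel M] B → a ⁻¹' B ∈ 𝓘.sets

variable {𝓘}

theorem SimpleFunction.integral_eq_double_sum (s t : 𝓘.SimpleFunction) :
    s.integral = ∑ k, ∑ l, s.val k *
      (𝓘.charge (s.cell ⁻¹' {k} ∩ t.cell ⁻¹' {l}) : ℝ) := by
  refine Finset.sum_congr rfl fun k _ => ?_
  rw [← Finset.mul_sum]
  congr 1
  have h : s.cell ⁻¹' {k} = ⋃ l, s.cell ⁻¹' {k} ∩ t.cell ⁻¹' {l} := by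
    ext i; simp
  have h' : 𝓘.charge (⋃ l, s.cell ⁻¹' {k} ∩ t.cell ⁻¹' {l}) =
      ∑ l, 𝓘.charge (s.cell ⁻¹' {k} ∩ t.cell ⁻¹' {l}) := by
    refine addContent_iUnion (fun l => 𝓘.isSetAlgebra.inter_mem (s.cell_mem k) (t.cell_mem l))
      ?_ (h ▸ s.cell_mem k)
    intro l l' hll
    refine Set.disjoint_left.2 fun i hi hi' => hll ?_
    rw [← hi.2, ← hi'.2]
  rw [← h] at h'
  rw [h']
  push_cast
  rfl

theorem SimpleFunction.integral_mono (s t : 𝓘.SimpleFunction)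
    (h : ∀ i, s.val (s.cell i) ≤ t.val (t.cell i)) : s.integral ≤ t.integral := by
  rw [s.integral_eq_double_sum t, t.integral_eq_double_sum s, Finset.sum_comm]
  refine Finset.sum_le_sum fun l _ => Finset.sum_le_sum fun k _ => ?_
  rw [Set.inter_comm]
  rcases Set.eq_empty_or_nonempty (t.cell ⁻¹' {l} ∩ s.cell ⁻¹' {k}) with he | ⟨i, hl, hk⟩
  · simp [he]
  · have hl : t.cell i = l := hl
    have hk : s.cell i = k := hk
    subst hl hk
    exact mul_le_mul_of_nonneg_right (h i) (NNReal.coe_nonneg _)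

variable (𝓘) in
/-- Constant simple functions. -/
def SimpleFunction.const (c : ℝ) : 𝓘.SimpleFunction where
  n := 1
  cell _ := 0
  cell_mem k := by
    rw [Subsingleton.elim k 0]
    simpa using 𝓘.isSetAlgebra.univ_mem
  val _ := c

theorem SimpleFunction.integral_const (c : ℝ) : (SimpleFunction.const 𝓘 c).integral = c := by
  change ∑ k : Fin 1, c * (𝓘.charge ((fun _ : I => (0 : Fin 1)) ⁻¹' {k}) : ℝ) = c
  simp [𝓘.charge_univ]

/-- Sums of simple functions. -/
def SimpleFunction.add (s t : 𝓘.SimpleFunction) : 𝓘.SimpleFunction where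
  n := s.n * t.n
  cell i := finProdFinEquiv (s.cell i, t.cell i)
  cell_mem k := by
    obtain ⟨⟨k, l⟩, rfl⟩ := finProdFinEquiv.surjective k
    convert! 𝓘.isSetAlgebra.inter_mem (s.cell_mem k) (t.cell_mem l) using 1
    ext i
    simp
  val k := s.val (finProdFinEquiv.symm k).1 + t.val (finProdFinEquiv.symm k).2

theorem SimpleFunction.add_apply (s t : 𝓘.SimpleFunction) (i : I) :
    (s.add t).val ((s.add t).cell i) = s.val (s.cell i) + t.val (t.cell i) := by
  simp [SimpleFunction.add]

theorem SimpleFunction.integral_add (s t : 𝓘.SimpleFunction) :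
    (s.add t).integral = s.integral + t.integral := by
  rw [s.integral_eq_double_sum t, t.integral_eq_double_sum s]
  rw [Finset.sum_comm (s := (Finset.univ : Finset (Fin t.n)))]
  rw [← Finset.sum_add_distrib]
  simp_rw [← Finset.sum_add_distrib]
  rw [← Fintype.sum_prod_type']
  refine (Equiv.sum_comp finProdFinEquiv _).symm.trans ?_
  refine Finset.sum_congr rfl fun p _ => ?_
  have h : (s.add t).cell ⁻¹' {finProdFinEquiv p} = s.cell ⁻¹' {p.1} ∩ t.cell ⁻¹' {p.2} := by
    ext i
    change finProdFinEquiv (s.cell i, t.cell i) = finProdFinEquiv p ↔ _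
    rw [finProdFinEquiv.injective.eq_iff]
    exact Prod.ext_iff
  rw [Set.inter_comm (t.cell ⁻¹' _), ← add_mul, ← h]
  change (s.val (finProdFinEquiv.symm (finProdFinEquiv p)).1 +
    t.val (finProdFinEquiv.symm (finProdFinEquiv p)).2) * _ = _
  rw [Equiv.symm_apply_apply]
  rfl

/-- Multiples of simple functions. -/
def SimpleFunction.smul (c : ℝ) (s : 𝓘.SimpleFunction) : 𝓘.SimpleFunction :=
  { s with val := fun k => c * s.val k }

theorem SimpleFunction.integral_smul (c : ℝ) (s : 𝓘.SimpleFunction) :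
    (s.smul c).integral = c * s.integral := by
  simp only [SimpleFunction.integral, SimpleFunction.smul, Finset.mul_sum, mul_assoc]
  rfl

theorem lowerSums_le_upperSums {f : I → ℝ} {x y : ℝ} (hx : x ∈ 𝓘.lowerSums f)
    (hy : y ∈ 𝓘.upperSums f) : x ≤ y := by
  obtain ⟨s, hs, rfl⟩ := hx
  obtain ⟨t, ht, rfl⟩ := hy
  exact s.integral_mono t fun i => (hs i).trans (ht i)

theorem mem_lowerSums_const {f : I → ℝ} {c : ℝ} (h : ∀ i, c ≤ f i) : c ∈ 𝓘.lowerSums f :=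
  ⟨SimpleFunction.const 𝓘 c, h, SimpleFunction.integral_const c⟩

theorem mem_upperSums_const {f : I → ℝ} {c : ℝ} (h : ∀ i, f i ≤ c) : c ∈ 𝓘.upperSums f :=
  ⟨SimpleFunction.const 𝓘 c, h, SimpleFunction.integral_const c⟩

section Bounded

variable {f g : I → ℝ} {B : ℝ}

theorem lowerSums_nonempty (h : ∀ i, |f i| ≤ B) : (𝓘.lowerSums f).Nonempty :=
  ⟨_, mem_lowerSums_const fun i => (abs_le.1 (h i)).1⟩

theorem upperSums_nonempty (h : ∀ i, |f i| ≤ B) : (𝓘.upperSums f).Nonempty :=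
  ⟨_, mem_upperSums_const fun i => (abs_le.1 (h i)).2⟩

theorem bddAbove_lowerSums (h : ∀ i, |f i| ≤ B) : BddAbove (𝓘.lowerSums f) :=
  ⟨B, fun _ hx => lowerSums_le_upperSums hx (mem_upperSums_const fun i => (abs_le.1 (h i)).2)⟩

theorem bddBelow_upperSums (h : ∀ i, |f i| ≤ B) : BddBelow (𝓘.upperSums f) :=
  ⟨-B, fun _ hx => lowerSums_le_upperSums (mem_lowerSums_const fun i => (abs_le.1 (h i)).1) hx⟩

theorem sSup_le_sInf (h : ∀ i, |f i| ≤ B) :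
    sSup (𝓘.lowerSums f) ≤ sInf (𝓘.upperSums f) :=
  csSup_le (lowerSums_nonempty h) fun _ hx =>
    le_csInf (upperSums_nonempty h) fun _ hy => lowerSums_le_upperSums hx hy

theorem integrable_of_le {x : ℝ} (h : ∀ i, |f i| ≤ B) (h₁ : x ≤ sSup (𝓘.lowerSums f))
    (h₂ : sInf (𝓘.upperSums f) ≤ x) : 𝓘.Integrable f ∧ 𝓘.integral f = x :=
  ⟨⟨⟨B, h⟩, le_antisymm (sSup_le_sInf h) (h₂.trans h₁)⟩,
    le_antisymm ((sSup_le_sInf h).trans h₂) h₁⟩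

theorem integrable_const (c : ℝ) :
    𝓘.Integrable (fun _ => c) ∧ 𝓘.integral (fun _ => c) = c := by
  have h : ∀ _ : I, |c| ≤ |c| := fun _ => le_rfl
  exact integrable_of_le h (le_csSup (bddAbove_lowerSums h) (mem_lowerSums_const fun _ => le_rfl))
    (csInf_le (bddBelow_upperSums h) (mem_upperSums_const fun _ => le_rfl))

theorem Integrable.add (hf : 𝓘.Integrable f) (hg : 𝓘.Integrable g) :
    𝓘.Integrable (fun i => f i + g i) ∧
      𝓘.integral (fun i => f i + g i) = 𝓘.integral f + 𝓘.integral g := by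
  obtain ⟨⟨B, hB⟩, hf⟩ := hf
  obtain ⟨⟨C, hC⟩, hg⟩ := hg
  have h : ∀ i, |f i + g i| ≤ B + C := fun i =>
    (abs_add_le _ _).trans (add_le_add (hB i) (hC i))
  refine integrable_of_le h ?_ ?_
  · rw [integral, integral, ← csSup_add (lowerSums_nonempty hB) (bddAbove_lowerSums hB)
      (lowerSums_nonempty hC) (bddAbove_lowerSums hC)]
    refine csSup_le_csSup (bddAbove_lowerSums h)
      ((lowerSums_nonempty hB).add (lowerSums_nonempty hC)) ?_
    rintro _ ⟨_, ⟨s, hs, rfl⟩, _, ⟨t, ht, rfl⟩, rfl⟩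
    refine ⟨s.add t, fun i => ?_, s.integral_add t⟩
    rw [s.add_apply]
    exact add_le_add (hs i) (ht i)
  · rw [integral, integral, hf, hg, ← csInf_add (upperSums_nonempty hB) (bddBelow_upperSums hB)
      (upperSums_nonempty hC) (bddBelow_upperSums hC)]
    refine csInf_le_csInf (bddBelow_upperSums h)
      ((upperSums_nonempty hB).add (upperSums_nonempty hC)) ?_
    rintro _ ⟨_, ⟨s, hs, rfl⟩, _, ⟨t, ht, rfl⟩, rfl⟩
    refine ⟨s.add t, fun i => ?_, s.integral_add t⟩
    rw [s.add_apply]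
    exact add_le_add (hs i) (ht i)

theorem Integrable.smul {c : ℝ} (hc : 0 ≤ c) (hf : 𝓘.Integrable f) :
    𝓘.Integrable (fun i => c * f i) ∧ 𝓘.integral (fun i => c * f i) = c * 𝓘.integral f := by
  obtain ⟨⟨B, hB⟩, hf⟩ := hf
  have h : ∀ i, |c * f i| ≤ c * B := fun i => by
    rw [abs_mul, abs_of_nonneg hc]
    exact mul_le_mul_of_nonneg_left (hB i) hc
  refine integrable_of_le h ?_ ?_
  · rw [integral, ← smul_eq_mul, ← Real.sSup_smul_of_nonneg hc]
    refine csSup_le_csSup (bddAbove_lowerSums h) ((lowerSums_nonempty hB).smul_set) ?_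
    rintro _ ⟨_, ⟨s, hs, rfl⟩, rfl⟩
    exact ⟨s.smul c, fun i => mul_le_mul_of_nonneg_left (hs i) hc, s.integral_smul c⟩
  · rw [integral, hf, ← smul_eq_mul, ← Real.sInf_smul_of_nonneg hc]
    refine csInf_le_csInf (bddBelow_upperSums h) ((upperSums_nonempty hB).smul_set) ?_
    rintro _ ⟨_, ⟨s, hs, rfl⟩, rfl⟩
    exact ⟨s.smul c, fun i => mul_le_mul_of_nonneg_left (hs i) hc, s.integral_smul c⟩

theorem Integrable.sum {n : ℕ} {f : Fin n → I → ℝ} (hf : ∀ k, 𝓘.Integrable (f k)) :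
    𝓘.Integrable (fun i => ∑ k, f k i) ∧
      𝓘.integral (fun i => ∑ k, f k i) = ∑ k, 𝓘.integral (f k) := by
  induction n with
  | zero => simpa using integrable_const (𝓘 := 𝓘) 0
  | succ n ih =>
    obtain ⟨h₁, h₂⟩ := ih fun k => hf k.succ
    simp_rw [Fin.sum_univ_succ]
    rw [← h₂]
    exact (hf 0).add h₁

theorem integral_mono (hf : 𝓘.Integrable f) (hg : 𝓘.Integrable g) (h : ∀ i, f i ≤ g i) :
    𝓘.integral f ≤ 𝓘.integral g := by
  obtain ⟨⟨B, hB⟩, hf⟩ := hf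
  obtain ⟨⟨C, hC⟩, hg⟩ := hg
  refine csSup_le_csSup (bddAbove_lowerSums hC) (lowerSums_nonempty hB) ?_
  rintro _ ⟨s, hs, rfl⟩
  exact ⟨s, fun i => (hs i).trans (h i), rfl⟩

/-- Bounded measurable functions are integrable. -/
theorem integrable_of_measurable (hB : ∀ i, |f i| ≤ B)
    (hf : ∀ r : ℝ, {i | f i < r} ∈ 𝓘.sets) : 𝓘.Integrable f := by
  refine ⟨⟨B, hB⟩, le_antisymm (sSup_le_sInf hB) (le_of_forall_pos_le_add fun ε hε => ?_)⟩
  have h0 : ∀ i, 0 ≤ (f i + B) / ε := fun i =>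
    div_nonneg (by linarith [(abs_le.1 (hB i)).1]) hε.le
  have hlt : ∀ i, ⌊(f i + B) / ε⌋₊ < ⌊(B + B) / ε⌋₊ + 1 := fun i => by
    refine Nat.lt_succ_of_le (Nat.floor_le_floor ?_)
    gcongr
    exact (abs_le.1 (hB i)).2
  have hmem : ∀ k : Fin (⌊(B + B) / ε⌋₊ + 1),
      (fun i => (⟨_, hlt i⟩ : Fin (⌊(B + B) / ε⌋₊ + 1))) ⁻¹' {k} ∈ 𝓘.sets := fun k => by
    convert! 𝓘.isSetAlgebra.sdiff_mem (hf (((k : ℕ) + 1 : ℝ) * ε - B))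
      (hf ((k : ℕ) * ε - B)) using 1
    ext i
    simp only [mem_preimage, mem_singleton_iff, Fin.ext_iff, mem_sdiff, mem_ofPred_eq, not_lt]
    rw [Nat.floor_eq_iff (h0 i), le_div_iff₀ hε, div_lt_iff₀ hε]
    constructor
    · rintro ⟨h₁, h₂⟩; constructor <;> linarith
    · rintro ⟨h₁, h₂⟩; constructor <;> linarith
  let s : 𝓘.SimpleFunction := ⟨_, _, hmem, fun k => (k : ℕ) * ε - B⟩
  have hs : ∀ i, s.val (s.cell i) ≤ f i := fun i => by
    have := Nat.floor_le (h0 i)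
    rw [le_div_iff₀ hε] at this
    change (⌊(f i + B) / ε⌋₊ : ℝ) * ε - B ≤ f i
    linarith
  have hs' : ∀ i, f i ≤ s.val (s.cell i) + ε := fun i => by
    have := (Nat.lt_floor_add_one ((f i + B) / ε)).le
    rw [div_le_iff₀ hε] at this
    change f i ≤ (⌊(f i + B) / ε⌋₊ : ℝ) * ε - B + ε
    linarith
  have h₁ : s.integral ≤ sSup (𝓘.lowerSums f) := le_csSup (bddAbove_lowerSums hB) ⟨s, hs, rfl⟩
  have h₂ : sInf (𝓘.upperSums f) ≤ s.integral + ε := by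
    refine csInf_le (bddBelow_upperSums hB) ⟨s.add (.const 𝓘 ε), fun i => ?_, ?_⟩
    · rw [s.add_apply]
      exact hs' i
    · rw [s.integral_add, SimpleFunction.integral_const]
  linarith

end Bounded

end ChargeSpace

/-! ### Meanable structures and the measurable powermean -/

/-- The topological weight: the least cardinality of a basis, plus `ℵ₀`. -/
def weight (M : Type w) [TopologicalSpace M] : Cardinal.{w} :=
  sInf {κ | ∃ O : Set (Set M), TopologicalSpace.IsTopologicalBasis O ∧ Cardinal.mk O = κ} +
    Cardinal.aleph0

/-- A family of sets is `κ`-complete if it is closed under intersections of fewer than `κ` of its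
members. -/
def IsCardinalComplete {I : Type v} (𝒜 : Set (Set I)) (κ : Cardinal.{w}) : Prop :=
  ∀ S ⊆ 𝒜, Cardinal.lift.{w} (Cardinal.mk S) < Cardinal.lift.{v} κ → ⋂₀ S ∈ 𝒜

/-- `M` is meanable if it is finite or the algebra is `w(M)⁺`-complete. -/
def Meanable {I : Type v} (𝓘 : ChargeSpace I) (M : Type w) [TopologicalSpace M] : Prop :=
  Finite M ∨ IsCardinalComplete 𝓘.sets (Order.succ (weight M))

section Measurability

variable {I : Type v} {𝓘 : ChargeSpace I} {M : Type w}

theorem exists_basis_card_le_weight [TopologicalSpace M] : ∃ O : Set (Set M),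
    TopologicalSpace.IsTopologicalBasis O ∧ Cardinal.mk O ≤ weight M := by
  obtain ⟨O, hO, h⟩ := csInf_mem (s := {κ | ∃ O : Set (Set M),
    TopologicalSpace.IsTopologicalBasis O ∧ Cardinal.mk O = κ})
    ⟨_, _, TopologicalSpace.isTopologicalBasis_opens, rfl⟩
  exact ⟨O, hO, h.le.trans (le_add_of_nonneg_right zero_le)⟩

theorem aleph0_le_weight [TopologicalSpace M] : Cardinal.aleph0 ≤ weight M :=
  le_add_of_nonneg_left zero_le

theorem iUnion_mem_of_card_le {κ : Cardinal.{w}} (h : IsCardinalComplete 𝓘.sets (Order.succ κ))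
    {J : Type w} (hJ : Cardinal.mk J ≤ κ) {A : J → Set I} (hA : ∀ j, A j ∈ 𝓘.sets) :
    ⋃ j, A j ∈ 𝓘.sets := by
  have h₁ : ⋂₀ (range fun j => (A j)ᶜ) ∈ 𝓘.sets := by
    refine h _ ?_ ?_
    · rintro _ ⟨j, rfl⟩
      exact 𝓘.isSetAlgebra.compl_mem (hA j)
    · refine Cardinal.mk_range_le_lift.trans_lt ?_
      rw [Cardinal.lift_lt]
      exact Order.lt_succ_of_le hJ
  have h₂ := 𝓘.isSetAlgebra.compl_mem h₁
  rwa [sInter_range, compl_iInter, iUnion_congr fun j => compl_compl (A j)] at h₂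

/-- Preimages of open sets under tuples of measurable maps into a meanable space. -/
theorem preimage_open_mem [MetricSpace M] (hM : Meanable 𝓘 M) {n : ℕ} {a : Fin n → I → M}
    (ha : ∀ k, 𝓘.IsMeasurable (a k)) {U : Set (Fin n → M)} (hU : IsOpen U) :
    {i | (fun k => a k i) ∈ U} ∈ 𝓘.sets := by
  have box : ∀ V : Fin n → Set M, (∀ k, IsOpen (V k)) →
      {i | ∀ k, a k i ∈ V k} ∈ 𝓘.sets := fun V hV => by
    have h := 𝓘.isSetAlgebra.biInter_mem (s := fun k => a k ⁻¹' V k) Finset.univ fun k _ =>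
      ha k _ (MeasurableSpace.measurableSet_generateFrom (hV k))
    convert! h using 1
    ext i
    simp
  rcases hM with hfin | hM
  · have := Fintype.ofFinite M
    classical
    have h := 𝓘.isSetAlgebra.biUnion_mem (s := fun x : Fin n → M => {i | ∀ k, a k i ∈ ({x k} : Set M)})
      (Finset.univ.filter (· ∈ U)) fun x _ => box _ fun k => isOpen_discrete _
    convert! h using 1
    ext i
    simp only [mem_ofPred_eq, mem_singleton_iff, mem_iUnion, Finset.mem_filter, Finset.mem_univ,
      true_and, exists_prop]
    constructor
    · exact fun hi => ⟨_, hi, fun k => rfl⟩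
    · rintro ⟨x, hx, hix⟩
      rwa [funext hix]
  · obtain ⟨O, hO, hcard⟩ := exists_basis_card_le_weight (M := M)
    let J : Type w := {V : Fin n → O // {x : Fin n → M | ∀ k, x k ∈ (V k : Set M)} ⊆ U}
    have hJ : Cardinal.mk J ≤ weight M := by
      refine (Cardinal.mk_subtype_le _).trans ?_
      rw [Cardinal.mk_arrow, Cardinal.mk_fin, Cardinal.lift_natCast, Cardinal.lift_uzero]
      refine (Cardinal.power_le_power_right hcard).trans ?_
      rw [Cardinal.power_natCast]
      exact Cardinal.power_nat_le aleph0_le_weight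
    have h := iUnion_mem_of_card_le hM hJ (A := fun V : J => {i | ∀ k, a k i ∈ (V.1 k : Set M)})
      fun V => box _ fun k => hO.isOpen (V.1 k).2
    convert! h using 1
    ext i
    simp only [mem_ofPred_eq, mem_iUnion]
    constructor
    · intro hi
      obtain ⟨V, hV, hVU⟩ := isOpen_pi_iff'.1 hU _ hi
      have : ∀ k, ∃ W ∈ O, a k i ∈ W ∧ W ⊆ V k := fun k =>
        hO.exists_subset_of_mem_open (hV k).2 (hV k).1
      choose W hWO hiW hWV using this
      exact ⟨⟨fun k => ⟨W k, hWO k⟩, fun x hx => hVU fun k _ => hWV k (hx k)⟩, hiW⟩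
    · rintro ⟨V, hV⟩
      exact V.2 hV

/-- Continuous bounded real functions of measurable maps are integrable. -/
theorem integrable_comp [MetricSpace M] (hM : Meanable 𝓘 M) {n : ℕ} {a : Fin n → I → M}
    (ha : ∀ k, 𝓘.IsMeasurable (a k)) {u : (Fin n → M) → ℝ} (hu : Continuous u) {B : ℝ}
    (hB : ∀ x, |u x| ≤ B) : 𝓘.Integrable (fun i => u fun k => a k i) :=
  ChargeSpace.integrable_of_measurable (fun _ => hB _) fun _ =>
    preimage_open_mem hM ha (isOpen_Iio.preimage hu)

/-- Continuous functions of measurable maps are measurable. -/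
theorem isMeasurable_comp [MetricSpace M] (hM : Meanable 𝓘 M) {n : ℕ} {a : Fin n → I → M}
    (ha : ∀ k, 𝓘.IsMeasurable (a k)) {u : (Fin n → M) → M} (hu : Continuous u) :
    𝓘.IsMeasurable (fun i => u fun k => a k i) := by
  intro B hB
  rcases id hM with hfin | hc
  · exact preimage_open_mem hM ha ((isOpen_discrete B).preimage hu)
  · induction B, hB using MeasurableSpace.generateFrom_induction with
    | hC U hU _ => exact preimage_open_mem hM ha (IsOpen.preimage hu hU)
    | empty => exact 𝓘.isSetAlgebra.empty_mem
    | compl t _ h => exact 𝓘.isSetAlgebra.compl_mem h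
    | iUnion s _ h =>
      rw [preimage_iUnion]
      have := iUnion_mem_of_card_le hc (J := ULift.{w} ℕ)
        (A := fun j => (fun i => u fun k => a k i) ⁻¹' s j.down)
        (by simpa using aleph0_le_weight) fun j => h j.down
      convert! this using 1
      ext i
      simp [ULift.exists]

theorem isMeasurable_const [TopologicalSpace M] (x : M) : 𝓘.IsMeasurable (fun _ => x) := by
  intro B _
  by_cases h : x ∈ B
  · simpa [h] using 𝓘.isSetAlgebra.univ_mem
  · simpa [h] using 𝓘.isSetAlgebra.empty_mem

end Measurability

section Powermean

variable {L : LipschitzLanguage.{u₁, u₂, u₃}} {I : Type v} {M : Type w} [MetricSpace M]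

theorem continuous_fn [Prestructure L M] (F : L.Fn) :
    Continuous (Prestructure.fn F : (Fin (L.fnArity F) → M) → M) := by
  refine continuous_iff_continuousAt.2 fun a => tendsto_iff_dist_tendsto_zero.2 ?_
  refine squeeze_zero (fun _ => dist_nonneg) (fun b => Prestructure.fn_lip F b a) ?_
  have : Continuous fun b : Fin (L.fnArity F) → M =>
      (L.fnLip F : ℝ) * ∑ k, dist (b k) (a k) := by fun_prop
  simpa using this.tendsto a

theorem continuous_rel [Prestructure L M] (R : L.Rel) :
    Continuous (Prestructure.rel R : (Fin (L.relArity R) → M) → ℝ) := by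
  refine continuous_iff_continuousAt.2 fun a => tendsto_iff_dist_tendsto_zero.2 ?_
  refine squeeze_zero (fun _ => dist_nonneg)
    (g := fun b => (L.relLip R : ℝ) * ∑ k, dist (b k) (a k)) (fun b => ?_) ?_
  · have h := Prestructure.rel_lip R a b
    simp_rw [dist_comm (a _)] at h
    rw [Real.dist_eq, abs_le]
    exact ⟨by linarith, Prestructure.rel_lip R b a⟩
  · have : Continuous fun b : Fin (L.relArity R) → M =>
        (L.relLip R : ℝ) * ∑ k, dist (b k) (a k) := by fun_prop
    simpa using this.tendsto a

/-- The measurable maps from the charge space to `M`, before identification. The language only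
serves to supply the bound on the diameter. -/
structure MeasurableMap (L : LipschitzLanguage.{u₁, u₂, u₃}) (𝓘 : ChargeSpace I) (M : Type w)
    [MetricSpace M] [Prestructure L M] (hM : Meanable 𝓘 M) where
  toFun : I → M
  measurable : 𝓘.IsMeasurable toFun

namespace MeasurableMap

variable {𝓘 : ChargeSpace I} [Prestructure L M] {hM : Meanable 𝓘 M}

instance instCoeFun : CoeFun (MeasurableMap L 𝓘 M hM) (fun _ => I → M) := ⟨toFun⟩

theorem integrable_dist (a b : MeasurableMap L 𝓘 M hM) :
    𝓘.Integrable (fun i => dist (a i) (b i)) :=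
  integrable_comp hM (a := ![a, b]) (u := fun x => dist (x 0) (x 1))
    (fun k => by fin_cases k <;> [exact a.measurable; exact b.measurable])
    (by fun_prop) (B := 1)
    (fun x => by rw [abs_of_nonneg dist_nonneg]; exact Prestructure.dist_le_one (L := L) _ _)

theorem integrable_rel (R : L.Rel) (a : Fin (L.relArity R) → MeasurableMap L 𝓘 M hM) :
    𝓘.Integrable (fun i => Prestructure.rel R fun k => a k i) :=
  integrable_comp hM (a := fun k => (a k).toFun) (fun k => (a k).measurable)
    (continuous_rel R) (B := 1) (fun x => by
      rw [abs_of_nonneg (Prestructure.rel_mem R x).1]; exact (Prestructure.rel_mem R x).2)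

/-- The pseudometric `d(a, b) = ∫ d(aᵢ, bᵢ) dμ`. -/
instance instPseudoMetricSpace : PseudoMetricSpace (MeasurableMap L 𝓘 M hM) where
  dist a b := 𝓘.integral fun i => dist (a i) (b i)
  dist_self a := by
    simpa using (ChargeSpace.integrable_const (𝓘 := 𝓘) 0).2
  dist_comm a b := by simp_rw [dist_comm]
  dist_triangle a b c := by
    obtain ⟨h₁, h₂⟩ := (integrable_dist a b).add (integrable_dist b c)
    rw [← h₂]
    exact ChargeSpace.integral_mono (integrable_dist a c) h₁ fun i => dist_triangle _ _ _

theorem dist_def (a b : MeasurableMap L 𝓘 M hM) :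
    dist a b = 𝓘.integral fun i => dist (a i) (b i) := rfl

theorem integrable_mul_sum {n : ℕ} (c : NNReal) (a b : Fin n → MeasurableMap L 𝓘 M hM) :
    𝓘.Integrable (fun i => c * ∑ k, dist (a k i) (b k i)) ∧
      𝓘.integral (fun i => c * ∑ k, dist (a k i) (b k i)) = c * ∑ k, dist (a k) (b k) := by
  obtain ⟨h₁, h₂⟩ := ChargeSpace.Integrable.sum fun k => integrable_dist (a k) (b k)
  obtain ⟨h₃, h₄⟩ := h₁.smul c.coe_nonneg
  exact ⟨h₃, by rw [h₄, h₂]; rfl⟩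

/-- Constants and function symbols are interpreted pointwise, relation symbols by integration. -/
instance instPrestructure : Prestructure L (MeasurableMap L 𝓘 M hM) where
  dist_le_one a b := by
    obtain ⟨h₁, h₂⟩ := ChargeSpace.integrable_const (𝓘 := 𝓘) 1
    rw [dist_def, ← h₂]
    exact ChargeSpace.integral_mono (integrable_dist a b) h₁ fun i =>
      Prestructure.dist_le_one (L := L) _ _
  const c := ⟨fun _ => Prestructure.const c, isMeasurable_const _⟩
  fn F a := ⟨fun i => Prestructure.fn F fun k => a k i,
    isMeasurable_comp hM (a := fun k => (a k).toFun) (fun k => (a k).measurable)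
      (continuous_fn F)⟩
  fn_lip F a b := by
    obtain ⟨h₁, h₂⟩ := integrable_mul_sum (L.fnLip F) a b
    rw [← h₂]
    exact ChargeSpace.integral_mono (integrable_dist _ _) h₁ fun i => Prestructure.fn_lip F _ _
  rel R a := 𝓘.integral fun i => Prestructure.rel R fun k => a k i
  rel_mem R a := by
    obtain ⟨h₁, h₂⟩ := ChargeSpace.integrable_const (𝓘 := 𝓘) 1
    obtain ⟨h₃, h₄⟩ := ChargeSpace.integrable_const (𝓘 := 𝓘) 0
    constructor
    · rw [← h₄]
      exact ChargeSpace.integral_mono h₃ (integrable_rel R a) fun i =>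
        (Prestructure.rel_mem R _).1
    · rw [← h₂]
      exact ChargeSpace.integral_mono (integrable_rel R a) h₁ fun i =>
        (Prestructure.rel_mem R _).2
  rel_lip R a b := by
    obtain ⟨h₁, h₂⟩ := integrable_mul_sum (L.relLip R) a b
    obtain ⟨h₃, h₄⟩ := (integrable_rel R b).add h₁
    rw [← h₂, sub_le_iff_le_add', ← h₄]
    exact ChargeSpace.integral_mono (integrable_rel R a) h₃ fun i => by
      have := Prestructure.rel_lip R (fun k => a k i) (fun k => b k i)
      linarith

end MeasurableMap

/-- The measurable powermean `M^μ`: measurable maps `a : I → M`, where `a` and `b` are identified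
if `∫ d(aᵢ, bᵢ) dμ = 0` (see `Powermean.mk_eq_mk`), with the induced metric and `L`-structure. -/
abbrev Powermean (L : LipschitzLanguage.{u₁, u₂, u₃}) (𝓘 : ChargeSpace I) (M : Type w)
    [MetricSpace M] [Prestructure L M] (hM : Meanable 𝓘 M) : Type (max v w) :=
  SeparationQuotient (MeasurableMap L 𝓘 M hM)

variable {𝓘 : ChargeSpace I} [Prestructure L M] {hM : Meanable 𝓘 M}

/-- The class `[aᵢ]` of a measurable map. -/
def Powermean.mk (a : MeasurableMap L 𝓘 M hM) : Powermean L 𝓘 M hM := SeparationQuotient.mk a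

theorem Powermean.mk_eq_mk (a b : MeasurableMap L 𝓘 M hM) :
    Powermean.mk a = Powermean.mk b ↔ 𝓘.integral (fun i => dist (a i) (b i)) = 0 :=
  SeparationQuotient.mk_eq_mk.trans Metric.inseparable_iff

/-- The diagonal map `x ↦ [x]`. -/
def Powermean.diagonal (hM : Meanable 𝓘 M) (x : M) : Powermean L 𝓘 M hM :=
  Powermean.mk ⟨fun _ => x, isMeasurable_const x⟩

end Powermean

end AffineLogic

end

open AffineLogic

open AffineLogic

/-! The identity is proved by induction on formulas in the prestructure of measurable maps, before
points at distance `0` are identified; `Formula.value_mk` transfers it to the quotient.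
Integrability needs no induction: a formula is bounded and Lipschitz, hence continuous, and bounded
continuous functions of measurable maps are integrable.

Atomic formulas hold by the definition of the structure, connectives by linearity of the integral,
and `inf` becomes `sup` by negation. The content is the case of `sup`. One inequality is pointwise.
For the other, given `ε > 0`, one needs a single measurable `b` with `φ(aᵢ, bᵢ) > supᵧ φ(aᵢ, y) - ε`
for every `i`. By continuity this is an open condition on `(aᵢ, bᵢ)`, so `b` can take its values in
a dense family: let `bᵢ` be the first admissible member under a well-ordering. The cells on which
`b` is constant lie in the algebra because it is closed under unions indexed by the family
(`Meanable.exists_isMeasurable_selection`). Completeness is asked of the algebra alone; finite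
additivity of the charge suffices. -/

namespace AffineLogic

universe u₁ u₂ u₃ v w

/-! ### Boundedness, continuity and quotient invariance of formula values -/

section General

variable {L : LipschitzLanguage.{u₁, u₂, u₃}} {M : Type w} [PseudoMetricSpace M] [Prestructure L M]

/-- Term values are Lipschitz. -/
theorem Term.exists_dist_value_le {n : ℕ} (t : Term L n) :
    ∃ K : ℝ, ∀ a b : Fin n → M, dist (t.value a) (t.value b) ≤ K * dist a b := by
  induction t with
  | var k => exact ⟨1, fun a b => by simpa [Term.value] using dist_le_pi_dist a b k⟩
  | const c => exact ⟨0, fun a b => by simp [Term.value]⟩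
  | app F t ih =>
    choose K hK using ih
    -- Tuples carry the maximum metric, while symbols are Lipschitz for the sum of the distances, so
    -- the constants of the arguments add up.
    refine ⟨L.fnLip F * ∑ k, K k, fun a b => (Prestructure.fn_lip F _ _).trans ?_⟩
    rw [mul_assoc, Finset.sum_mul]
    exact mul_le_mul_of_nonneg_left (Finset.sum_le_sum fun k _ => hK k a b) (L.fnLip F).coe_nonneg

variable (M) in
/-- Formula values are uniformly bounded. -/
theorem Formula.exists_abs_value_le {n : ℕ} (φ : Formula L n) :
    ∃ B : ℝ, 0 ≤ B ∧ ∀ a : Fin n → M, |φ.value a| ≤ B := by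
  induction φ with
  | one => exact ⟨1, zero_le_one, fun a => by simp [Formula.value]⟩
  | dist t₁ t₂ =>
    refine ⟨1, zero_le_one, fun a => ?_⟩
    rw [Formula.value, abs_of_nonneg dist_nonneg]
    exact Prestructure.dist_le_one (L := L) _ _
  | rel R t =>
    refine ⟨1, zero_le_one, fun a => ?_⟩
    have h := Prestructure.rel_mem R fun k => (t k).value a
    rw [Formula.value, abs_of_nonneg h.1]
    exact h.2
  | add φ ψ ih₁ ih₂ =>
    obtain ⟨B, hB0, hB⟩ := ih₁
    obtain ⟨C, hC0, hC⟩ := ih₂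
    exact ⟨B + C, add_nonneg hB0 hC0, fun a => (abs_add_le _ _).trans (add_le_add (hB a) (hC a))⟩
  | smul r φ ih =>
    obtain ⟨B, hB0, hB⟩ := ih
    refine ⟨|r| * B, mul_nonneg (abs_nonneg r) hB0, fun a => ?_⟩
    rw [Formula.value, abs_mul]
    exact mul_le_mul_of_nonneg_left (hB a) (abs_nonneg r)
  | inf φ ih =>
    obtain ⟨B, hB0, hB⟩ := ih
    refine ⟨B, hB0, fun a => ?_⟩
    rw [Formula.value]
    rcases isEmpty_or_nonempty M with h | ⟨⟨x⟩⟩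
    -- A real infimum over an empty type is `0` by convention; this is where `0 ≤ B` is needed.
    · simpa [Real.iInf_of_isEmpty] using hB0
    · have hb : BddBelow (range fun b : M => φ.value (Fin.snoc a b : Fin (_ + 1) → M)) :=
        ⟨-B, by rintro _ ⟨b, rfl⟩; exact (abs_le.1 (hB _)).1⟩
      have : Nonempty M := ⟨x⟩
      exact abs_le.2 ⟨le_ciInf fun b => (abs_le.1 (hB _)).1,
        (ciInf_le hb x).trans (abs_le.1 (hB _)).2⟩
  | sup φ ih =>
    obtain ⟨B, hB0, hB⟩ := ih
    refine ⟨B, hB0, fun a => ?_⟩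
    rw [Formula.value]
    rcases isEmpty_or_nonempty M with h | ⟨⟨x⟩⟩
    · simpa [Real.iSup_of_isEmpty] using hB0
    · have hb : BddAbove (range fun b : M => φ.value (Fin.snoc a b : Fin (_ + 1) → M)) :=
        ⟨B, by rintro _ ⟨b, rfl⟩; exact (abs_le.1 (hB _)).2⟩
      have : Nonempty M := ⟨x⟩
      exact abs_le.2 ⟨(abs_le.1 (hB _)).1.trans (le_ciSup hb x),
        ciSup_le fun b => (abs_le.1 (hB _)).2⟩

theorem Formula.bddBelow_range_value_snoc {n : ℕ} (φ : Formula L (n + 1)) (a : Fin n → M) :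
    BddBelow (range fun b : M => φ.value (Fin.snoc a b : Fin (n + 1) → M)) := by
  obtain ⟨B, -, hB⟩ := φ.exists_abs_value_le M
  exact ⟨-B, by rintro _ ⟨b, rfl⟩; exact (abs_le.1 (hB _)).1⟩

theorem Formula.bddAbove_range_value_snoc {n : ℕ} (φ : Formula L (n + 1)) (a : Fin n → M) :
    BddAbove (range fun b : M => φ.value (Fin.snoc a b : Fin (n + 1) → M)) := by
  obtain ⟨B, -, hB⟩ := φ.exists_abs_value_le M
  exact ⟨B, by rintro _ ⟨b, rfl⟩; exact (abs_le.1 (hB _)).2⟩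

/-- A common last coordinate contributes `0` to the maximum metric, so quantifying over it preserves
a Lipschitz constant. -/
theorem dist_snoc_left {n : ℕ} (a a' : Fin n → M) (b : M) :
    dist (Fin.snoc a b : Fin (n + 1) → M) (Fin.snoc a' b : Fin (n + 1) → M) ≤ dist a a' := by
  refine (dist_pi_le_iff dist_nonneg).2 fun k => ?_
  refine Fin.lastCases ?_ (fun k => ?_) k
  · simp
  · simpa using dist_le_pi_dist a a' k

/-- Formula values are Lipschitz. -/
theorem Formula.exists_value_sub_value_le {n : ℕ} (φ : Formula L n) :
    ∃ K : ℝ, 0 ≤ K ∧ ∀ a b : Fin n → M, φ.value a - φ.value b ≤ K * Dist.dist a b := by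
  induction φ with
  | one => exact ⟨0, le_rfl, fun a b => by simp [Formula.value]⟩
  | dist t₁ t₂ =>
    obtain ⟨K₁, h₁⟩ := t₁.exists_dist_value_le (M := M)
    obtain ⟨K₂, h₂⟩ := t₂.exists_dist_value_le (M := M)
    -- The constants for terms are not known to be nonnegative; the absolute value makes this one
    -- so, as the quantifier steps require.
    refine ⟨|K₁ + K₂|, abs_nonneg _, fun a b => ?_⟩
    refine le_trans ?_ (mul_le_mul_of_nonneg_right (le_abs_self _) dist_nonneg)
    have h := dist_triangle4 (t₁.value a) (t₁.value b) (t₂.value b) (t₂.value a)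
    rw [dist_comm (t₂.value b)] at h
    simp only [Formula.value]
    linarith [h₁ a b, h₂ a b]
  | rel R t =>
    choose K hK using fun k => (t k).exists_dist_value_le (M := M)
    refine ⟨|L.relLip R * ∑ k, K k|, abs_nonneg _, fun a b => ?_⟩
    refine le_trans ?_ (mul_le_mul_of_nonneg_right (le_abs_self _) dist_nonneg)
    refine (Prestructure.rel_lip R _ _).trans ?_
    rw [mul_assoc, Finset.sum_mul]
    exact mul_le_mul_of_nonneg_left (Finset.sum_le_sum fun k _ => hK k a b) (L.relLip R).coe_nonneg
  | add φ ψ ih₁ ih₂ =>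
    obtain ⟨K₁, h₁, hK₁⟩ := ih₁
    obtain ⟨K₂, h₂, hK₂⟩ := ih₂
    refine ⟨K₁ + K₂, add_nonneg h₁ h₂, fun a b => ?_⟩
    simp only [Formula.value]
    linarith [hK₁ a b, hK₂ a b]
  | smul r φ ih =>
    obtain ⟨K, h, hK⟩ := ih
    refine ⟨|r| * K, mul_nonneg (abs_nonneg r) h, fun a b => ?_⟩
    -- A negative `r` reverses the one-sided bound, so it is used in both directions.
    have h₁ := hK a b
    have h₂ := hK b a
    rw [dist_comm b a] at h₂
    simp only [Formula.value]
    rw [← mul_sub, mul_assoc]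
    refine (le_abs_self _).trans ?_
    rw [abs_mul]
    exact mul_le_mul_of_nonneg_left (abs_le.2 ⟨by linarith, h₁⟩) (abs_nonneg r)
  | inf φ ih =>
    obtain ⟨K, h, hK⟩ := ih
    refine ⟨K, h, fun a b => ?_⟩
    simp only [Formula.value]
    rcases isEmpty_or_nonempty M with hM | hM
    · simpa [Real.iInf_of_isEmpty] using mul_nonneg h dist_nonneg
    · rw [sub_le_iff_le_add, ← sub_le_iff_le_add']
      refine le_ciInf fun c => ?_
      have h₁ := ciInf_le (φ.bddBelow_range_value_snoc a) c
      have h₂ := hK (Fin.snoc a c) (Fin.snoc b c)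
      have h₃ := mul_le_mul_of_nonneg_left (dist_snoc_left a b c) h
      linarith
  | sup φ ih =>
    obtain ⟨K, h, hK⟩ := ih
    refine ⟨K, h, fun a b => ?_⟩
    simp only [Formula.value]
    rcases isEmpty_or_nonempty M with hM | hM
    · simpa [Real.iSup_of_isEmpty] using mul_nonneg h dist_nonneg
    · rw [sub_le_iff_le_add]
      refine ciSup_le fun c => ?_
      have h₁ := le_ciSup (φ.bddAbove_range_value_snoc b) c
      have h₂ := hK (Fin.snoc a c) (Fin.snoc b c)
      have h₃ := mul_le_mul_of_nonneg_left (dist_snoc_left a b c) h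
      linarith

/-- Used twice: for integrability along measurable maps, and for the openness of the relation to be
uniformized in the `sup` step. -/
theorem Formula.continuous_value {n : ℕ} (φ : Formula L n) :
    Continuous (φ.value : (Fin n → M) → ℝ) := by
  obtain ⟨K, hK0, hK⟩ := φ.exists_value_sub_value_le (M := M)
  lift K to NNReal using hK0
  refine (LipschitzWith.of_dist_le_mul (K := K) fun a b => ?_).continuous
  have h := hK b a
  rw [dist_comm b a] at h
  rw [Real.dist_eq]
  exact abs_le.2 ⟨by linarith, hK a b⟩

/-- Leaves `sup` as the only quantifier to treat. Real `sInf` is defined as the negated `sSup` of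
the negated set, so empty ranges need no separate case. -/
theorem Formula.value_inf_eq {n : ℕ} (φ : Formula L (n + 1)) (a : Fin n → M) :
    φ.inf.value a = (Formula.smul (-1) (Formula.smul (-1) φ).sup).value a := by
  simp only [Formula.value, neg_one_mul]
  rw [iSup, iInf, Real.sInf_def]
  congr 2
  ext r
  simp [neg_eq_iff_eq_neg]

theorem Term.value_mk {n : ℕ} (t : Term L n) (a : Fin n → M) :
    t.value (fun k => SeparationQuotient.mk (a k)) = SeparationQuotient.mk (t.value a) := by
  induction t with
  | var k => rfl
  | const c => rfl
  | app F t ih =>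
    simp only [Term.value, ih]
    exact mk_fn F _

theorem mk_snoc {n : ℕ} (a : Fin n → M) (b : M) :
    (Fin.snoc (fun k => SeparationQuotient.mk (a k)) (SeparationQuotient.mk b) :
      Fin (n + 1) → SeparationQuotient M) =
      fun k => SeparationQuotient.mk ((Fin.snoc a b : Fin (n + 1) → M) k) := by
  funext k
  refine Fin.lastCases ?_ (fun k => ?_) k <;> simp

/-- Passing to the quotient metric space does not change the values of formulas. -/
theorem Formula.value_mk {n : ℕ} (φ : Formula L n) (a : Fin n → M) :
    φ.value (fun k => SeparationQuotient.mk (a k)) = φ.value a := by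
  induction φ with
  | one => rfl
  | dist t₁ t₂ => simp only [Formula.value, Term.value_mk, SeparationQuotient.dist_mk]
  | rel R t =>
    simp only [Formula.value, Term.value_mk]
    exact mk_rel R _
  | add φ ψ ih₁ ih₂ => simp only [Formula.value, ih₁, ih₂]
  | smul r φ ih => simp only [Formula.value, ih]
  | inf φ ih =>
    simp only [Formula.value]
    rw [← SeparationQuotient.surjective_mk.iInf_comp]
    simp only [mk_snoc, ih]
  | sup φ ih =>
    simp only [Formula.value]
    rw [← SeparationQuotient.surjective_mk.iSup_comp]
    simp only [mk_snoc, ih]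

end General

/-! ### Measurable selection -/

section Selection

variable {I : Type v} {𝓘 : ChargeSpace I} {M : Type w}

/-- For a meanable space there is a dense family whose index type is so small that the algebra is
closed under unions over it. -/
theorem Meanable.exists_denseRange [TopologicalSpace M] (hM : Meanable 𝓘 M) :
    ∃ (J : Type w) (x : J → M), DenseRange x ∧
      ∀ A : J → Set I, (∀ j, A j ∈ 𝓘.sets) → ⋃ j, A j ∈ 𝓘.sets := by
  rcases hM with hfin | hM
  · have := Fintype.ofFinite M
    refine ⟨M, id, denseRange_id, fun A hA => ?_⟩
    simpa using 𝓘.isSetAlgebra.biUnion_mem (s := A) Finset.univ fun x _ => hA x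
  · obtain ⟨O, hO, hcard⟩ := exists_basis_card_le_weight (M := M)
    -- One point from each nonempty member of a base of cardinality at most `w(M)`.
    refine ⟨{V : O // (V : Set M).Nonempty}, fun V => V.2.some, ?_, fun A hA =>
      iUnion_mem_of_card_le hM ((Cardinal.mk_subtype_le _).trans hcard) hA⟩
    refine hO.dense_iff.2 fun V hV hne => ?_
    exact ⟨_, hne.some_mem, ⟨⟨⟨V, hV⟩, hne⟩, rfl⟩⟩

/-- Measurable selection: an open relation all of whose sections are nonempty can be uniformized
along measurable maps. -/
theorem Meanable.exists_isMeasurable_selection [MetricSpace M] (hM : Meanable 𝓘 M) {n : ℕ}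
    {a : Fin n → I → M} (ha : ∀ k, 𝓘.IsMeasurable (a k)) {U : Set ((Fin n → M) × M)}
    (hU : IsOpen U) (hne : ∀ x, ∃ y, (x, y) ∈ U) :
    ∃ b : I → M, 𝓘.IsMeasurable b ∧ ∀ i, ((fun k => a k i), b i) ∈ U := by
  obtain ⟨J, x, hx, hJ⟩ := hM.exists_denseRange
  -- Unions over part of `J` reduce to unions over `J` by putting `∅` outside `S`.
  have hsub : ∀ (S : Set J) (A : J → Set I), (∀ j, A j ∈ 𝓘.sets) → ⋃ j ∈ S, A j ∈ 𝓘.sets :=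
    fun S A hA => hJ _ fun j => by
      by_cases h : j ∈ S
      · simpa [h] using hA j
      · simpa [h] using 𝓘.isSetAlgebra.empty_mem
  -- The indices at which `x j` is an admissible value. These sets cover `I`, since each section of
  -- `U` is open and nonempty and so meets the dense family.
  let A : J → Set I := fun j => {i | ((fun k => a k i), x j) ∈ U}
  have hA : ∀ j, A j ∈ 𝓘.sets := fun j =>
    preimage_open_mem hM ha (U := {z | (z, x j) ∈ U}) (hU.preimage (by fun_prop))
  have hcover : ∀ i, {j | i ∈ A j}.Nonempty := fun i => by
    have hopen : IsOpen {y | ((fun k => a k i), y) ∈ U} := hU.preimage (by fun_prop)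
    obtain ⟨_, hy, j, rfl⟩ := hx.inter_open_nonempty _ hopen (hne _)
    exact ⟨j, hy⟩
  -- Disjointification along a well-ordering: `c i` is the least admissible index at `i`, so its
  -- fibre over `j` is `A j` minus all earlier sets.
  have wf : WellFounded (WellOrderingRel : J → J → Prop) := WellOrderingRel.isWellOrder.wf
  let c : I → J := fun i => wf.min _ (hcover i)
  have hc : ∀ j, c ⁻¹' {j} = A j \ ⋃ l ∈ {l | WellOrderingRel l j}, A l := fun j => by
    ext i
    simp only [mem_preimage, mem_singleton_iff, mem_sdiff, mem_iUnion, mem_ofPred_eq, exists_prop,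
      not_exists, not_and]
    constructor
    · rintro rfl
      exact ⟨wf.min_mem _ (hcover i), fun l hl hi => wf.not_lt_min _ hi hl⟩
    · rintro ⟨hi, hmin⟩
      rcases trichotomous_of WellOrderingRel (c i) j with h | h | h
      · exact absurd (wf.min_mem _ (hcover i)) (hmin _ h)
      · exact h
      · exact absurd h (wf.not_lt_min _ hi)
  refine ⟨fun i => x (c i), fun B _ => ?_, fun i => wf.min_mem _ (hcover i)⟩
  -- The preimage of `B` is the union of the cells whose assigned point lies in `B`.
  have h := hsub (x ⁻¹' B) (fun j => c ⁻¹' {j}) fun j => by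
    rw [hc]
    exact 𝓘.isSetAlgebra.sdiff_mem (hA j) (hsub _ _ hA)
  convert! h using 1
  ext i
  simp

end Selection

/-! ### Complements on charges -/

namespace ChargeSpace

variable {I : Type v} {𝓘 : ChargeSpace I}

/-- An empty `I` would have charge `0` rather than `1`. Needed to evaluate a measurable map
somewhere when `M` may be empty. -/
theorem nonempty (𝓘 : ChargeSpace I) : Nonempty I := by
  by_contra h
  rw [not_nonempty_iff] at h
  have h₁ := 𝓘.charge_univ
  rw [univ_eq_empty_iff.2 h, addContent_empty] at h₁
  exact zero_ne_one h₁

/-- Additivity applied to `f + (-f) = 0`. Integrability of `-f` comes for free in the application,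
where `-f` is again given by a formula. -/
theorem Integrable.neg {f : I → ℝ} (hf : 𝓘.Integrable f) (hf' : 𝓘.Integrable fun i => -f i) :
    𝓘.integral (fun i => -f i) = -𝓘.integral f := by
  have h := (hf.add hf').2
  simp only [add_neg_cancel, (integrable_const (𝓘 := 𝓘) 0).2] at h
  linarith

end ChargeSpace

/-! ### The induction on formulas -/

section Powermean

variable {L : LipschitzLanguage.{u₁, u₂, u₃}} {I : Type v} {M : Type w} [MetricSpace M]
  {𝓘 : ChargeSpace I} [Prestructure L M] {hM : Meanable 𝓘 M}

namespace MeasurableMap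

theorem integrable_value {n : ℕ} (φ : Formula L n) (a : Fin n → MeasurableMap L 𝓘 M hM) :
    𝓘.Integrable (fun i => φ.value fun k => a k i) := by
  obtain ⟨B, -, hB⟩ := φ.exists_abs_value_le M
  exact integrable_comp hM (a := fun k => (a k).toFun) (fun k => (a k).measurable)
    φ.continuous_value hB

theorem term_value_apply {n : ℕ} (t : Term L n) (a : Fin n → MeasurableMap L 𝓘 M hM) (i : I) :
    t.value a i = t.value (fun k => a k i) := by
  induction t with
  | var k => rfl
  | const c => rfl
  | app F t ih =>
    simp only [Term.value, ← ih]
    rfl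

theorem snoc_apply {n : ℕ} (a : Fin n → MeasurableMap L 𝓘 M hM) (b : MeasurableMap L 𝓘 M hM)
    (i : I) :
    (fun k => (Fin.snoc a b : Fin (n + 1) → MeasurableMap L 𝓘 M hM) k i) =
      (Fin.snoc (fun k => a k i) (b i) : Fin (n + 1) → M) := by
  funext k
  refine Fin.lastCases ?_ (fun k => ?_) k <;> simp

theorem nonempty_iff : Nonempty (MeasurableMap L 𝓘 M hM) ↔ Nonempty M := by
  have := 𝓘.nonempty
  exact ⟨fun ⟨a⟩ => ⟨a (Classical.arbitrary I)⟩, fun ⟨x⟩ => ⟨⟨fun _ => x, isMeasurable_const x⟩⟩⟩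

/-- Values are attained up to `ε` along measurable maps. -/
theorem exists_lt_value {n : ℕ} (φ : Formula L (n + 1)) {s : (Fin n → M) → ℝ} (hs : Continuous s)
    (h : ∀ x, ∃ y, s x < φ.value (Fin.snoc x y : Fin (n + 1) → M))
    (a : Fin n → MeasurableMap L 𝓘 M hM) :
    ∃ b : MeasurableMap L 𝓘 M hM, ∀ i,
      s (fun k => a k i) < φ.value (Fin.snoc (fun k => a k i) (b i) : Fin (n + 1) → M) := by
  have hc : Continuous fun p : (Fin n → M) × M =>
      φ.value (Fin.snoc p.1 p.2 : Fin (n + 1) → M) :=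
    φ.continuous_value.comp (by fun_prop)
  obtain ⟨b, hb, hbU⟩ := hM.exists_isMeasurable_selection (a := fun k => (a k).toFun)
    (fun k => (a k).measurable) (isOpen_lt (hs.comp continuous_fst) hc) h
  exact ⟨⟨b, hb⟩, hbU⟩

theorem integral_value_smul {n : ℕ} (r : ℝ) (φ : Formula L n)
    (a : Fin n → MeasurableMap L 𝓘 M hM) :
    𝓘.integral (fun i => (Formula.smul r φ).value fun k => a k i) =
      r * 𝓘.integral (fun i => φ.value fun k => a k i) := by
  have hf := integrable_value φ a
  rcases le_total 0 r with hr | hr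
  · exact (hf.smul hr).2
  · obtain ⟨h₁, h₂⟩ := hf.smul (neg_nonneg.2 hr)
    -- Homogeneity is known only for nonnegative factors: scale by `-r`, then negate.
    have h := h₁.neg (by simpa [Formula.value] using integrable_value (Formula.smul r φ) a)
    rw [h₂] at h
    simpa [Formula.value] using h

/-- A supremum commutes with the integral because almost optimal witnesses can be chosen measurably
in `i`. The hypothesis `ih` is kept abstract so that the `inf` case can apply the lemma to a negated
formula. -/
theorem value_sup_eq_integral {n : ℕ} (φ : Formula L (n + 1))
    (ih : ∀ a : Fin (n + 1) → MeasurableMap L 𝓘 M hM,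
      φ.value a = 𝓘.integral fun i => φ.value fun k => a k i)
    (a : Fin n → MeasurableMap L 𝓘 M hM) :
    φ.sup.value a = 𝓘.integral fun i => φ.sup.value fun k => a k i := by
  rcases isEmpty_or_nonempty M with hE | hN
  · have : IsEmpty (MeasurableMap L 𝓘 M hM) := by
      rwa [← not_nonempty_iff, nonempty_iff, not_nonempty_iff]
    -- Both sides are suprema over empty types, with default value `0`.
    simpa [Formula.value, Real.iSup_of_isEmpty] using
      (ChargeSpace.integrable_const (𝓘 := 𝓘) 0).2.symm
  have : Nonempty (MeasurableMap L 𝓘 M hM) := nonempty_iff.2 hN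
  refine le_antisymm (ciSup_le fun b => ?_) (le_of_forall_pos_le_add fun ε hε => ?_)
  · rw [ih]
    refine ChargeSpace.integral_mono (integrable_value φ _) (integrable_value φ.sup a) fun i => ?_
    rw [snoc_apply]
    exact le_ciSup (φ.bddAbove_range_value_snoc fun k => a k i) (b i)
  -- A measurable `b` that is `ε`-optimal at every index; integrating costs only `ε`, as the total
  -- charge is `1`.
  · obtain ⟨b, hb⟩ := exists_lt_value φ (s := fun x => φ.sup.value x - ε)
      (φ.sup.continuous_value.sub continuous_const)
      (fun x => exists_lt_of_lt_ciSup (sub_lt_self (φ.sup.value x) hε)) a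
    have h := le_ciSup (φ.bddAbove_range_value_snoc a) b
    obtain ⟨h₁, h₂⟩ := (integrable_value φ (Fin.snoc a b)).add
      (ChargeSpace.integrable_const (𝓘 := 𝓘) ε).1
    rw [(ChargeSpace.integrable_const (𝓘 := 𝓘) ε).2, ← ih] at h₂
    refine le_trans ?_ (add_le_add_left h ε)
    rw [← h₂]
    refine ChargeSpace.integral_mono (integrable_value φ.sup a) h₁ fun i => ?_
    rw [snoc_apply]
    linarith [hb i]

/-- The value of a formula at a tuple of measurable maps is the integral of its values. -/
theorem value_eq_integral {n : ℕ} (φ : Formula L n) (a : Fin n → MeasurableMap L 𝓘 M hM) :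
    φ.value a = 𝓘.integral fun i => φ.value fun k => a k i := by
  induction φ with
  | one => exact (ChargeSpace.integrable_const (𝓘 := 𝓘) 1).2.symm
  | dist t₁ t₂ => simp only [Formula.value, dist_def, term_value_apply]
  | rel R t =>
    simp only [Formula.value, ← term_value_apply]
    rfl
  | add φ ψ ih₁ ih₂ =>
    rw [Formula.value, ih₁, ih₂]
    exact ((integrable_value φ a).add (integrable_value ψ a)).2.symm
  | smul r φ ih => rw [integral_value_smul, Formula.value, ih]
  | sup φ ih => exact value_sup_eq_integral φ ih a
  | inf φ ih =>
    -- Treat `inf φ` as `-sup (-φ)`; the induction hypothesis passes from `φ` to `-φ` by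
    -- homogeneity.
    have h := value_sup_eq_integral (Formula.smul (-1) φ)
      (fun b => by rw [integral_value_smul, Formula.value, ih]) a
    have h' := integral_value_smul (-1) (Formula.smul (-1) φ).sup a
    rw [← h] at h'
    simp only [← Formula.value_inf_eq] at h'
    exact (φ.value_inf_eq a).trans h'.symm

end MeasurableMap

end Powermean

end AffineLogic

theorem mainTheorem6 (L : LipschitzLanguage) {I : Type*}
    (𝓘 : ChargeSpace I) (M : Type*) [MetricSpace M] [CompleteSpace M] [Prestructure L M]
    (hM : Meanable 𝓘 M) :
    (∀ (n : ℕ) (φ : Formula L n) (a : Fin n → MeasurableMap L 𝓘 M hM),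
      𝓘.Integrable (fun i => φ.value (fun k => a k i)) ∧
      φ.value (fun k => Powermean.mk (a k)) = 𝓘.integral (fun i => φ.value (fun k => a k i))) ∧
    IsElementaryEmbedding L (Powermean.diagonal hM : M → Powermean L 𝓘 M hM) := by
  have key : ∀ (n : ℕ) (φ : Formula L n) (a : Fin n → MeasurableMap L 𝓘 M hM),
      φ.value (fun k => Powermean.mk (a k)) = 𝓘.integral (fun i => φ.value (fun k => a k i)) :=
    fun n φ a => (φ.value_mk a).trans (MeasurableMap.value_eq_integral φ a)
  refine ⟨fun n φ a => ⟨MeasurableMap.integrable_value φ a, key n φ a⟩, fun n φ a => ?_⟩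
  -- Along constant maps the integrand is the constant `φ.value a`, which is its own integral.
  have h := key n φ fun k => ⟨fun _ => a k, isMeasurable_const (a k)⟩
  exact (h.trans (ChargeSpace.integrable_const (𝓘 := 𝓘) (φ.value a)).2).symm
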